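/- Let $\Omega\subset\mathbb{R}^3$ be an open set (not necessarily bounded; for instance a domain with Lipschitz boundary), and let $\varepsilon,\mu,\sigma\in L^\infty(\Omega,\mathbb{R}^{3\times3})$ be symmetric matrix-valued functions such that, for some constants $\varepsilon_{\min},\varepsilon_{\max},\mu_{\min},\mu_{\max},\sigma_{\max}$, almost everywhere in $\Omega$ and for all $\eta\in\mathbb{R}^3$ with $|\eta|=1$, $$0<\varepsilon_{\min}\le\eta\cdot\varepsilon\eta\le\varepsilon_{\max},\qquad 0<\mu_{\min}\le\eta\cdot\mu\eta\le\mu_{\max},\qquad 0\le\eta\cdot\sigma\eta\le\sigma_{\max}.$$ Let $\operatorname{curl}$ be the distributional curl in $L^2(\Omega)^3=L^2(\Omega,\mathbb{C}^3)$ on its maximal domain $H(\operatorname{curl},\Omega)=\{u\in L^2(\Omega)^3:\operatorname{curl}u\in L^2(\Omega)^3\}$, and let $\operatorname{curl}_0=\operatorname{curl}^*$ be its adjoint, that is, the restriction of $\operatorname{curl}$ to $$H_0(\operatorname{curl},\Omega)=\{u\in H(\operatorname{curl},\Omega):\langle\operatorname{curl}u,v\rangle=\langle u,\operatorname{curl}v\rangle\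 \text{for all } v\in H(\operatorname{curl},\Omega)\}$$ (for a Lipschitz domain these are the $u\in H(\operatorname{curl},\Omega)$ with $\nu\times u=0$ on $\partial\Omega$, where $\nu$ is the outward unit normal). For $\omega\in\mathbb{C}$ consider in $L^2(\Omega)^3\oplus L^2(\Omega)^3$ the Maxwell pencil $$V(\omega)=\begin{pmatrix}-i\sigma & i\operatorname{curl}\\ -i\operatorname{curl}_0 & 0\end{pmatrix}-\omega\begin{pmatrix}\varepsilon&0\\0&\mu\end{pmatrix},\qquad \operatorname{dom}V(\omega)=H_0(\operatorname{curl},\Omega)\oplus H(\operatorname{curl},\Omega).$$ **Theorem.** (i) For every $\omega\in\mathbb{C}\setminus i\mathbb{R}$ with $\operatorname{Im}\omega<-\frac12\frac{\sigma_{\max}}{\varepsilon_{\min}}$, the operator $V(\omega)$ is a bijection from its domain onto $L^2(\Omega)^3\oplus L^2(\Omega)^3$ with bounded inverse, and $$\|V(\omega)^{-1}\|\le\frac1{\min\{\varepsilon_{\min},\mu_{\min}\}}\,\frac1{|\operatorname{Im}\omega|-\frac12\frac{\sigma_{\max}}{\varepsilon_{\min}}}\left(1+\frac{\big(\frac12\frac{\sigma_{\max}}{\varepsilon_{\min}}\big)^2}{(\operatorname{Re}\omega)^2}\right).$$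 (ii) For every $\omega\in\mathbb{C}$ with $\operatorname{Im}\omega<-\frac{\sigma_{\max}}{\varepsilon_{\min}}$, the operator $V(\omega)$ is likewise boundedly invertible, and $$\|V(\omega)^{-1}\|\le\frac1{\min\{\varepsilon_{\min},\mu_{\min}\}}\min\left\{\frac1{|\operatorname{Im}\omega|-\frac12\frac{\sigma_{\max}}{\varepsilon_{\min}}}\left(1+\frac{\big(\frac12\frac{\sigma_{\max}}{\varepsilon_{\min}}\big)^2}{(\operatorname{Re}\omega)^2}\right),\ \frac1{|\operatorname{Im}\omega|-\frac{\sigma_{\max}}{\varepsilon_{\min}}}\right\},$$ where for $\operatorname{Re}\omega=0$ the first entry of the minimum is read as $+\infty$. -/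

import Mathlib

open MeasureTheory

noncomputable section

namespace Maxwell

/-- Euclidean space `ℝ³`. -/
abbrev R3 : Type := EuclideanSpace ℝ (Fin 3)

/-- The space `ℂ³` with its Hermitian norm. -/
abbrev C3 : Type := EuclideanSpace ℂ (Fin 3)

/-- Lebesgue measure on the open set `Ω ⊆ ℝ³`. -/
abbrev vol (Ω : TopologicalSpace.Opens R3) : Measure R3 := volume.restrict (Ω : Set R3)

/-- The Hilbert space `L²(Ω)³ = L²(Ω, ℂ³)`. -/
abbrev L2 (Ω : TopologicalSpace.Opens R3) : Type := Lp C3 2 (vol Ω)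

/-- The Hilbert space `L²(Ω)³ ⊕ L²(Ω)³`. -/
abbrev L2L2 (Ω : TopologicalSpace.Opens R3) : Type := WithLp 2 (L2 Ω × L2 Ω)

/-- The space `L^∞(Ω, ℝ^{3×3})` of real `3 × 3` matrix functions with entries in `L^∞(Ω)`. -/
abbrev LinftyMatrix (Ω : TopologicalSpace.Opens R3) : Type :=
  Matrix (Fin 3) (Fin 3) (Lp ℝ ⊤ (vol Ω))

/-- The bounds `lo ≤ η · a(x) η ≤ hi` for almost every `x ∈ Ω` and every unit vector `η ∈ ℝ³`. -/
def FormBounds {Ω : TopologicalSpace.Opens R3} (a : LinftyMatrix Ω) (lo hi : ℝ) : Prop :=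
  ∀ᵐ x ∂(vol Ω), ∀ η : R3, ‖η‖ = 1 →
    lo ≤ ∑ i, ∑ j, η i * a i j x * η j ∧ ∑ i, ∑ j, η i * a i j x * η j ≤ hi

lemma memLp_mul {Ω : TopologicalSpace.Opens R3} (a : LinftyMatrix Ω) (u : L2 Ω) :
    MemLp (fun x => (WithLp.toLp 2 fun i => ∑ j, (a i j x : ℂ) * u x j : C3)) 2 (vol Ω) := by
  refine MemLp.of_eval_piLp fun i => ?_
  refine memLp_finsetSum (f := fun j x => (a i j x : ℂ) * u x j) Finset.univ fun j _ => ?_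
  exact ((Lp.memLp u).eval_piLp j).mul' (Lp.memLp (a i j)).ofReal

/-- The multiplication operator `u ↦ a u` in `L²(Ω)³` by a matrix function `a`. -/
def mulOp {Ω : TopologicalSpace.Opens R3} (a : LinftyMatrix Ω) : L2 Ω →ₗ[ℂ] L2 Ω where
  toFun u := (memLp_mul a u).toLp _
  map_add' u v := by
    rw [← MemLp.toLp_add, MemLp.toLp_eq_toLp_iff]
    filter_upwards [Lp.coeFn_add u v] with x hx
    ext i
    simp only [hx, Pi.add_apply, PiLp.add_apply, mul_add, Finset.sum_add_distrib]
  map_smul' c u := by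
    rw [RingHom.id_apply, ← MemLp.toLp_const_smul, MemLp.toLp_eq_toLp_iff]
    filter_upwards [Lp.coeFn_smul c u] with x hx
    ext i
    simp only [hx, Pi.smul_apply, PiLp.smul_apply, smul_eq_mul, Finset.mul_sum, mul_left_comm]

/-- The partial derivative `∂ᵢ φₖ` of a differentiable vector field. -/
def pderiv (φ : R3 → C3) (i k : Fin 3) (x : R3) : ℂ :=
  (fderiv ℝ φ x (EuclideanSpace.single i 1)) k

/-- The classical curl of a differentiable vector field. -/
def classicalCurl (φ : R3 → C3) (x : R3) : C3 :=
  !₂[pderiv φ 1 2 x - pderiv φ 2 1 x,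
     pderiv φ 2 0 x - pderiv φ 0 2 x,
     pderiv φ 0 1 x - pderiv φ 1 0 x]

/-- `φ ∈ C_c^∞(Ω)³`. -/
structure IsTestField (Ω : TopologicalSpace.Opens R3) (φ : R3 → C3) : Prop where
  smooth : ContDiff ℝ (⊤ : ℕ∞) φ
  compact : HasCompactSupport φ
  supp : tsupport φ ⊆ Ω

/-- `curl u = w` in `Ω` in the sense of distributions. The inner product is the Hermitian one,
conjugate-linear in its first argument, the test field. -/
def IsWeakCurl {Ω : TopologicalSpace.Opens R3} (u w : L2 Ω) : Prop :=
  ∀ φ : R3 → C3, IsTestField Ω φ →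
    ∫ x in (Ω : Set R3), inner ℂ (classicalCurl φ x) (u x) =
      ∫ x in (Ω : Set R3), inner ℂ (φ x) (w x)

lemma IsTestField.continuous_curl {Ω : TopologicalSpace.Opens R3} {φ : R3 → C3}
    (h : IsTestField Ω φ) : Continuous (classicalCurl φ) := by
  have hd : ∀ i k, Continuous (pderiv φ i k) := fun i k => by
    have h1 : Continuous fun x => fderiv ℝ φ x (EuclideanSpace.single i 1) :=
      (h.smooth.continuous_fderiv (by simp)).clm_apply continuous_const
    exact (EuclideanSpace.proj (𝕜 := ℂ) k).continuous.comp h1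
  refine (PiLp.continuous_toLp 2 _).comp (continuous_pi fun i => ?_)
  fin_cases i
  · exact (hd 1 2).sub (hd 2 1)
  · exact (hd 2 0).sub (hd 0 2)
  · exact (hd 0 1).sub (hd 1 0)

lemma IsTestField.compact_curl {Ω : TopologicalSpace.Opens R3} {φ : R3 → C3}
    (h : IsTestField Ω φ) : HasCompactSupport (classicalCurl φ) := by
  refine (h.compact.fderiv (𝕜 := ℝ)).mono fun x hx => ?_
  contrapose! hx
  have h0 : fderiv ℝ φ x = 0 := by simpa using hx
  have : classicalCurl φ x = 0 := by
    ext i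
    fin_cases i <;> simp [classicalCurl, pderiv, h0]
  simpa using this

lemma integrable_inner_of_test {Ω : TopologicalSpace.Opens R3} {ψ : R3 → C3}
    (hc : Continuous ψ) (hs : HasCompactSupport ψ) (u : L2 Ω) :
    Integrable (fun x => inner ℂ (ψ x) (u x)) (vol Ω) := by
  have hψ : MemLp ψ 2 (vol Ω) := hc.memLp_of_hasCompactSupport hs
  have := L2.integrable_inner (𝕜 := ℂ) hψ.toLp u
  refine this.congr ?_
  filter_upwards [hψ.coeFn_toLp] with x hx
  rw [hx]

/-- The graph of `curl` on its maximal domain in `L²(Ω)³`. -/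
def curlGraph (Ω : TopologicalSpace.Opens R3) : Submodule ℂ (L2 Ω × L2 Ω) where
  carrier := {p | IsWeakCurl p.1 p.2}
  zero_mem' := fun φ hφ => by
    have h0 : ((0 : L2 Ω) : R3 → C3) =ᵐ[vol Ω] 0 := Lp.coeFn_zero _ _ _
    have key : ∀ ψ : R3 → C3, ∫ x in (Ω : Set R3), inner ℂ (ψ x) ((0 : L2 Ω) x) = 0 := by
      intro ψ
      rw [integral_congr_ae (g := fun _ => (0 : ℂ)), integral_zero]
      filter_upwards [h0] with x hx
      rw [hx, Pi.zero_apply, inner_zero_right]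
    simp only [Prod.fst_zero, Prod.snd_zero]
    rw [key, key]
  add_mem' := fun {p q} hp hq φ hφ => by
    have key : ∀ (ψ : R3 → C3), Continuous ψ → HasCompactSupport ψ → ∀ u v : L2 Ω,
        ∫ x in (Ω : Set R3), inner ℂ (ψ x) ((u + v : L2 Ω) x) =
          (∫ x in (Ω : Set R3), inner ℂ (ψ x) (u x)) +
            ∫ x in (Ω : Set R3), inner ℂ (ψ x) (v x) := by
      intro ψ hc hs u v
      rw [← integral_add (integrable_inner_of_test hc hs u) (integrable_inner_of_test hc hs v)]
      refine integral_congr_ae ?_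
      filter_upwards [Lp.coeFn_add u v] with x hx
      rw [hx, Pi.add_apply, inner_add_right]
    have h1 := hp φ hφ
    have h2 := hq φ hφ
    simp only [Prod.fst_add, Prod.snd_add]
    rw [key _ hφ.continuous_curl hφ.compact_curl, key _ hφ.smooth.continuous hφ.compact, h1, h2]
  smul_mem' := fun c p hp φ hφ => by
    have key : ∀ (ψ : R3 → C3) (u : L2 Ω),
        ∫ x in (Ω : Set R3), inner ℂ (ψ x) ((c • u : L2 Ω) x) =
          c * ∫ x in (Ω : Set R3), inner ℂ (ψ x) (u x) := by
      intro ψ u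
      rw [← integral_const_mul]
      refine integral_congr_ae ?_
      filter_upwards [Lp.coeFn_smul c u] with x hx
      rw [hx, Pi.smul_apply, inner_smul_right]
    simp only [Prod.smul_fst, Prod.smul_snd]
    rw [key, key, hp φ hφ]

/-- The distributional curl is unique, so `curlGraph Ω` is the graph of an operator. -/
lemma curlGraph_single_valued (Ω : TopologicalSpace.Opens R3) :
    ∀ p : L2 Ω × L2 Ω, p ∈ curlGraph Ω → p.1 = 0 → p.2 = 0 := by
  rintro ⟨u, w⟩ hp (rfl : u = 0)
  have hp : IsWeakCurl (0 : L2 Ω) w := hp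
  have hcomp : ∀ i : Fin 3, ∀ᵐ x ∂(vol Ω), w x i = 0 := by
    intro i
    have hloc : LocallyIntegrable (fun x => w x i) (vol Ω) :=
      ((Lp.memLp w).eval_piLp i).locallyIntegrable (by norm_num)
    have := Ω.isOpen.ae_eq_zero_of_integral_contDiff_smul_eq_zero (μ := vol Ω)
      (f := fun x => w x i) (hloc.locallyIntegrableOn _) ?_
    · filter_upwards [this, ae_restrict_mem Ω.isOpen.measurableSet] with x hx hxΩ
      exact hx hxΩ
    · intro g hg hgc hgs
      have hφ : IsTestField Ω (fun x => g x • (EuclideanSpace.single i 1 : C3)) :=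
        ⟨hg.smul contDiff_const, hgc.smul_right, (tsupport_smul_subset_left _ _).trans hgs⟩
      have h1 := hp _ hφ
      rw [integral_congr_ae (g := fun _ => (0 : ℂ))] at h1
      · rw [integral_zero] at h1
        rw [h1]
        refine integral_congr_ae (Filter.Eventually.of_forall fun x => ?_)
        simp [PiLp.inner_apply, mul_comm]
      · filter_upwards [Lp.coeFn_zero C3 2 (vol Ω)] with x hx
        rw [hx, Pi.zero_apply, inner_zero_right]
  refine (Lp.eq_zero_iff_ae_eq_zero).2 ?_
  filter_upwards [ae_all_iff.2 hcomp] with x hx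
  ext i
  exact hx i

/-- The operator `curl` in `L²(Ω)³` on its maximal domain `H(curl, Ω)`. -/
def curl (Ω : TopologicalSpace.Opens R3) : L2 Ω →ₗ.[ℂ] L2 Ω := (curlGraph Ω).toLinearPMap

theorem mem_curl_graph {Ω : TopologicalSpace.Opens R3} {u w : L2 Ω} :
    (u, w) ∈ (curl Ω).graph ↔ IsWeakCurl u w := by
  rw [curl, Submodule.toLinearPMap_graph_eq _ (curlGraph_single_valued Ω)]
  rfl

/-- The space `H(curl, Ω)` of all `u ∈ L²(Ω)³` with distributional curl in `L²(Ω)³`. -/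
def Hcurl (Ω : TopologicalSpace.Opens R3) : Submodule ℂ (L2 Ω) := (curl Ω).domain

/-- The space `H₀(curl, Ω)` of all `u ∈ H(curl, Ω)` with `ν × u = 0` on `∂Ω`; the vanishing of the
tangential trace is expressed by Green's formula `⟨curl u, v⟩ = ⟨u, curl v⟩` for all
`v ∈ H(curl, Ω)`, so that `H₀(curl, Ω)` is the domain of the adjoint of `curl`. -/
def H0curl (Ω : TopologicalSpace.Opens R3) : Submodule ℂ (L2 Ω) where
  carrier := {u | ∃ hu : u ∈ Hcurl Ω, ∀ v : Hcurl Ω,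
    inner ℂ (curl Ω ⟨u, hu⟩) (v : L2 Ω) = inner ℂ u (curl Ω v)}
  zero_mem' := ⟨Submodule.zero_mem _, fun v => by
    have : curl Ω ⟨0, Submodule.zero_mem _⟩ = 0 := (curl Ω).map_zero
    rw [this, inner_zero_left, inner_zero_left]⟩
  add_mem' := by
    rintro u u' ⟨hu, h⟩ ⟨hu', h'⟩
    refine ⟨Submodule.add_mem _ hu hu', fun v => ?_⟩
    have : curl Ω ⟨u + u', Submodule.add_mem _ hu hu'⟩ = curl Ω ⟨u, hu⟩ + curl Ω ⟨u', hu'⟩ :=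
      (curl Ω).map_add ⟨u, hu⟩ ⟨u', hu'⟩
    rw [this, inner_add_left, inner_add_left, h v, h' v]
  smul_mem' := by
    rintro c u ⟨hu, h⟩
    refine ⟨Submodule.smul_mem _ c hu, fun v => ?_⟩
    have : curl Ω ⟨c • u, Submodule.smul_mem _ c hu⟩ = c • curl Ω ⟨u, hu⟩ :=
      (curl Ω).map_smul c ⟨u, hu⟩
    rw [this, inner_smul_left, inner_smul_left, h v]

lemma H0curl_le (Ω : TopologicalSpace.Opens R3) : H0curl Ω ≤ (curl Ω).domain :=
  fun _ hu => hu.1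

/-- The operator `curl₀`, the restriction of `curl` to `H₀(curl, Ω)`. -/
def curl0 (Ω : TopologicalSpace.Opens R3) : L2 Ω →ₗ.[ℂ] L2 Ω where
  domain := H0curl Ω
  toFun := (curl Ω).toFun ∘ₗ Submodule.inclusion (H0curl_le Ω)

/-- The domain `H₀(curl, Ω) ⊕ H(curl, Ω)` of the Maxwell pencil. -/
def pencilDomain (Ω : TopologicalSpace.Opens R3) : Submodule ℂ (L2L2 Ω) where
  carrier := {p | p.fst ∈ (curl0 Ω).domain ∧ p.snd ∈ (curl Ω).domain}
  zero_mem' := ⟨Submodule.zero_mem _, Submodule.zero_mem _⟩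
  add_mem' := fun hp hq => ⟨Submodule.add_mem _ hp.1 hq.1, Submodule.add_mem _ hp.2 hq.2⟩
  smul_mem' := fun c _ hp => ⟨Submodule.smul_mem _ c hp.1, Submodule.smul_mem _ c hp.2⟩

/-- The Maxwell pencil
`V(ω)(E, H) = (-iσE + i curl H - ωεE, -i curl₀ E - ωμH)` with domain
`H₀(curl, Ω) ⊕ H(curl, Ω)`, an unbounded operator in `L²(Ω)³ ⊕ L²(Ω)³`. -/
def pencil {Ω : TopologicalSpace.Opens R3} (ε μ σ : LinftyMatrix Ω) (ω : ℂ) :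
    L2L2 Ω →ₗ.[ℂ] L2L2 Ω where
  domain := pencilDomain Ω
  toFun :=
    { toFun := fun p => WithLp.toLp 2
        (-Complex.I • mulOp σ (p : L2L2 Ω).fst + Complex.I • curl Ω ⟨(p : L2L2 Ω).snd, p.2.2⟩
            - ω • mulOp ε (p : L2L2 Ω).fst,
          -Complex.I • curl0 Ω ⟨(p : L2L2 Ω).fst, p.2.1⟩ - ω • mulOp μ (p : L2L2 Ω).snd)
      map_add' := fun p q => by
        have h1 : curl Ω ⟨((p + q : pencilDomain Ω) : L2L2 Ω).snd, (p + q).2.2⟩ =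
            curl Ω ⟨(p : L2L2 Ω).snd, p.2.2⟩ + curl Ω ⟨(q : L2L2 Ω).snd, q.2.2⟩ :=
          (curl Ω).map_add ⟨(p : L2L2 Ω).snd, p.2.2⟩ ⟨(q : L2L2 Ω).snd, q.2.2⟩
        have h2 : curl0 Ω ⟨((p + q : pencilDomain Ω) : L2L2 Ω).fst, (p + q).2.1⟩ =
            curl0 Ω ⟨(p : L2L2 Ω).fst, p.2.1⟩ + curl0 Ω ⟨(q : L2L2 Ω).fst, q.2.1⟩ :=
          (curl0 Ω).map_add ⟨(p : L2L2 Ω).fst, p.2.1⟩ ⟨(q : L2L2 Ω).fst, q.2.1⟩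
        rw [h1, h2, ← WithLp.toLp_add, Prod.mk_add_mk]
        simp only [Submodule.coe_add, WithLp.add_fst, WithLp.add_snd, map_add, smul_add]
        congr 2 <;> abel
      map_smul' := fun c p => by
        have h1 : curl Ω ⟨((c • p : pencilDomain Ω) : L2L2 Ω).snd, (c • p).2.2⟩ =
            c • curl Ω ⟨(p : L2L2 Ω).snd, p.2.2⟩ :=
          (curl Ω).map_smul c ⟨(p : L2L2 Ω).snd, p.2.2⟩
        have h2 : curl0 Ω ⟨((c • p : pencilDomain Ω) : L2L2 Ω).fst, (c • p).2.1⟩ =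
            c • curl0 Ω ⟨(p : L2L2 Ω).fst, p.2.1⟩ :=
          (curl0 Ω).map_smul c ⟨(p : L2L2 Ω).fst, p.2.1⟩
        rw [h1, h2, RingHom.id_apply, ← WithLp.toLp_smul, Prod.smul_mk]
        simp only [Submodule.coe_smul, WithLp.smul_fst, WithLp.smul_snd, map_smul, smul_add,
          smul_sub, smul_comm c] }

/-- `R = T⁻¹`: the operator `T` is a bijection of its domain onto the whole space and the bounded,
everywhere defined operator `R` is its inverse. -/
def IsBoundedInverse {X : Type*} [NormedAddCommGroup X] [NormedSpace ℂ X]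
    (T : X →ₗ.[ℂ] X) (R : X →L[ℂ] X) : Prop :=
  (∀ f : X, ∃ h : R f ∈ T.domain, T ⟨R f, h⟩ = f) ∧ ∀ u : T.domain, R (T u) = u

end Maxwell

end

open MeasureTheory

noncomputable section

namespace Maxwell

/-! ### Closed operators that are bounded below -/

section BoundedInverse

variable {X : Type*} [NormedAddCommGroup X]

/-! Write `u = (E, H)`, `V(ω)u = (f, g)`, let `e`, `h`, `q` be the quadratic forms of `ε`, `μ`, `σ`
at `E`, `H`, `E`, and put `τ = -Im ω`, `s = σmax / (2 εmin)`. By Green's formula the curl terms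
cancel both in `Im (⟨E, f⟩ + ⟨H, g⟩) = τ(e + h) - q` and in `Re (⟨E, f⟩ - ⟨H, g⟩) = -Re ω (e - h)`
(`pencil_quadratic_form`).

Since `q ≤ 2s e = s(e + h) + s(e - h)`, the first identity controls `(τ - s)(e + h)` up to the error
`s|e - h|`, and the second identity controls this error at the price of the factor `s / |Re ω|`.
With the Cauchy–Schwarz inequality and `e + h ≥ min εmin μmin * ‖u‖²` this bounds `V(ω)` below
(`pencil_lower_bound_of_re_ne_zero`). The cruder estimate `q ≤ 2s(e + h)` needs only the first
identity and gives the other bound (`pencil_lower_bound`).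

For surjectivity, `curl` and `curl0` are adjoint to each other, so `V(ω)` is the full adjoint of the
pencil with `-σ` and conjugate `ω` (`exists_pencil_eq_of_forall_inner`). Hence it is closed. The
formal adjoint obeys the same lower bounds, since the signs of `σ` and `Im ω` flip together, so the
range of `V(ω)` has trivial orthogonal complement. -/

lemma IsBoundedInverse.norm_le [NormedSpace ℂ X] {T : X →ₗ.[ℂ] X} {R : X →L[ℂ] X}
    (hR : IsBoundedInverse T R) {c : ℝ} (hc : 0 < c) (hT : ∀ u : T.domain, c * ‖u‖ ≤ ‖T u‖) :
    ‖R‖ ≤ c⁻¹ := by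
  refine R.opNorm_le_bound (by positivity) fun f => ?_
  obtain ⟨h, hf⟩ := hR.1 f
  have := hT ⟨R f, h⟩
  rw [hf] at this
  rw [inv_mul_eq_div, le_div_iff₀ hc, mul_comm]
  exact this

/-- The range of a closed operator that is bounded below is closed. -/
lemma isClosed_range_of_bounded_below [NormedSpace ℂ X] [CompleteSpace X] {T : X →ₗ.[ℂ] X}
    (hcl : T.IsClosed) {c : ℝ} (hc : 0 < c) (hT : ∀ u : T.domain, c * ‖u‖ ≤ ‖T u‖) :
    IsClosed (LinearMap.range T.toFun : Set X) := by
  have hG : CompleteSpace T.graph := IsClosed.completeSpace_coe (hs := hcl)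
  -- The range is the image of the complete graph under the second projection, so it suffices that
  -- this projection is antilipschitz.
  let snd : T.graph →L[ℂ] X := (ContinuousLinearMap.snd ℂ X X).comp T.graph.subtypeL
  -- The product carries the sup norm: `c⁻¹` serves the first component and `1` the second.
  have hanti : AntilipschitzWith (max c⁻¹ 1).toNNReal snd := by
    refine AddMonoidHomClass.antilipschitz_of_bound snd fun p => ?_
    obtain ⟨u, hu1, hu2⟩ := (T.mem_graph_iff).1 p.2
    have h1 : c * ‖(u : X)‖ ≤ ‖T u‖ := hT u
    rw [hu1, hu2] at h1
    have hmax : c⁻¹ ≤ max c⁻¹ 1 := le_max_left _ _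
    have hmax' : 1 ≤ max c⁻¹ 1 := le_max_right _ _
    rw [Real.coe_toNNReal _ (by positivity)]
    change ‖(p : X × X)‖ ≤ _ * ‖(p : X × X).2‖
    rw [Prod.norm_def, max_le_iff]
    constructor
    · calc ‖(p : X × X).1‖ = c⁻¹ * (c * ‖(p : X × X).1‖) := by field_simp
        _ ≤ c⁻¹ * ‖(p : X × X).2‖ := by gcongr
        _ ≤ _ := by gcongr
    · exact le_mul_of_one_le_left (norm_nonneg _) hmax'
  convert hanti.isClosed_range snd.uniformContinuous using 1
  ext f
  simp only [LinearMap.coe_range, Set.mem_range]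
  constructor
  · rintro ⟨u, rfl⟩
    exact ⟨⟨_, T.mem_graph u⟩, rfl⟩
  · rintro ⟨p, rfl⟩
    obtain ⟨u, -, hu⟩ := (T.mem_graph_iff).1 p.2
    exact ⟨u, hu⟩

/-- A closed operator that is bounded below and has dense range is boundedly invertible. -/
lemma exists_isBoundedInverse [InnerProductSpace ℂ X] [CompleteSpace X] {T : X →ₗ.[ℂ] X}
    (hcl : T.IsClosed) {c : ℝ} (hc : 0 < c) (hT : ∀ u : T.domain, c * ‖u‖ ≤ ‖T u‖)
    (hdense : ∀ w : X, (∀ u : T.domain, inner ℂ (T u) w = 0) → w = 0) :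
    ∃ R : X →L[ℂ] X, IsBoundedInverse T R := by
  have hrange : LinearMap.range T.toFun = ⊤ := by
    have := (isClosed_range_of_bounded_below hcl hc hT).completeSpace_coe
    rw [← Submodule.orthogonal_eq_bot_iff, Submodule.eq_bot_iff]
    intro w hw
    exact hdense w fun u => (Submodule.mem_orthogonal _ w).1 hw _ ⟨u, rfl⟩
  have hinj : Function.Injective T.toFun := by
    rw [← LinearMap.ker_eq_bot, LinearMap.ker_eq_bot']
    intro u hu
    have h1 := hT u
    rw [show T u = 0 from hu, norm_zero] at h1
    have h2 : ‖u‖ ≤ 0 := by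
      by_contra! h
      exact absurd h1 (not_le.2 (mul_pos hc h))
    exact norm_le_zero_iff.1 h2
  let e := LinearEquiv.ofBijective T.toFun ⟨hinj, LinearMap.range_eq_top.1 hrange⟩
  have he : ∀ u, e u = T u := fun _ => rfl
  refine ⟨(T.domain.subtype ∘ₗ e.symm.toLinearMap).mkContinuous c⁻¹ fun f => ?_,
    fun f => ⟨(e.symm f).2, e.apply_symm_apply f⟩, fun u => ?_⟩
  · have h1 := hT (e.symm f)
    rw [← he, e.apply_symm_apply] at h1
    rw [inv_mul_eq_div, le_div_iff₀ hc, mul_comm]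
    exact h1
  · change ((e.symm (e u) : T.domain) : X) = u
    rw [e.symm_apply_apply]

end BoundedInverse

/-! ### Multiplication by matrix functions and their quadratic forms -/

section MulOp

variable {Ω : TopologicalSpace.Opens R3}

lemma coeFn_mulOp (a : LinftyMatrix Ω) (u : L2 Ω) :
    mulOp a u =ᵐ[vol Ω] fun x => WithLp.toLp 2 fun i => ∑ j, (a i j x : ℂ) * u x j :=
  (memLp_mul a u).coeFn_toLp

lemma mulOp_neg (a : LinftyMatrix Ω) (u : L2 Ω) : mulOp (-a) u = -mulOp a u := by
  refine Lp.ext ?_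
  have h : ∀ᵐ x ∂(vol Ω), ∀ i j, (-a) i j x = -a i j x :=
    ae_all_iff.2 fun i => ae_all_iff.2 fun j => Lp.coeFn_neg (a i j)
  filter_upwards [coeFn_mulOp (-a) u, coeFn_mulOp a u, Lp.coeFn_neg (mulOp a u), h]
    with x h1 h2 h3 h4
  rw [h1, h3, Pi.neg_apply, h2]
  ext i
  simp only [h4, Complex.ofReal_neg, neg_mul, Finset.sum_neg_distrib, PiLp.neg_apply]

lemma inner_mulOp_symm {a : LinftyMatrix Ω} (ha : a.IsSymm) (u v : L2 Ω) :
    inner ℂ (mulOp a u) v = inner ℂ u (mulOp a v) := by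
  rw [L2.inner_def, L2.inner_def]
  refine integral_congr_ae ?_
  filter_upwards [coeFn_mulOp a u, coeFn_mulOp a v] with x h1 h2
  rw [h1, h2]
  simp only [PiLp.inner_apply, RCLike.inner_apply, map_sum, map_mul, Complex.conj_ofReal,
    Finset.mul_sum, Finset.sum_mul]
  rw [Finset.sum_comm]
  refine Finset.sum_congr rfl fun i _ => Finset.sum_congr rfl fun j _ => ?_
  rw [ha.apply i j]
  ring

lemma im_inner_mulOp {a : LinftyMatrix Ω} (ha : a.IsSymm) (u : L2 Ω) :
    (inner ℂ u (mulOp a u)).im = 0 := by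
  have h := inner_conj_symm (𝕜 := ℂ) (mulOp a u) u
  rw [inner_mulOp_symm ha] at h
  exact Complex.conj_eq_iff_im.1 h

lemma quadratic_bounds {m : Fin 3 → Fin 3 → ℝ} {lo hi : ℝ}
    (h : ∀ η : R3, ‖η‖ = 1 →
      lo ≤ ∑ i, ∑ j, η i * m i j * η j ∧ ∑ i, ∑ j, η i * m i j * η j ≤ hi) (η : R3) :
    lo * ‖η‖ ^ 2 ≤ ∑ i, ∑ j, η i * m i j * η j ∧
      ∑ i, ∑ j, η i * m i j * η j ≤ hi * ‖η‖ ^ 2 := by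
  rcases eq_or_ne η 0 with rfl | hη
  · simp
  have hn : 0 < ‖η‖ := norm_pos_iff.2 hη
  have h1 := h (‖η‖⁻¹ • η) (norm_smul_inv_norm hη)
  have h2 : ∑ i, ∑ j, (‖η‖⁻¹ • η) i * m i j * (‖η‖⁻¹ • η) j =
      (∑ i, ∑ j, η i * m i j * η j) / ‖η‖ ^ 2 := by
    simp only [PiLp.smul_apply, smul_eq_mul, Finset.sum_div]
    refine Finset.sum_congr rfl fun i _ => Finset.sum_congr rfl fun j _ => ?_
    field_simp
  rw [h2, le_div_iff₀ (by positivity), div_le_iff₀ (by positivity)] at h1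
  exact h1

/-- The entries are real, so products of a real part with an imaginary part contribute only to the
imaginary part of the form. This carries bounds over real vectors to complex ones. -/
lemma re_inner_matrix {m : Fin 3 → Fin 3 → ℝ} (z : C3) :
    (inner ℂ z (WithLp.toLp 2 fun i => ∑ j, (m i j : ℂ) * z j : C3)).re =
      (∑ i, ∑ j, (z i).re * m i j * (z j).re) + ∑ i, ∑ j, (z i).im * m i j * (z j).im := by
  simp only [PiLp.inner_apply, RCLike.inner_apply, Complex.re_sum, Finset.sum_mul,
    ← Finset.sum_add_distrib]
  refine Finset.sum_congr rfl fun i _ => Finset.sum_congr rfl fun j _ => ?_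
  simp
  ring

lemma FormBounds.re_inner_bounds {a : LinftyMatrix Ω} {lo hi : ℝ} (h : FormBounds a lo hi)
    (u : L2 Ω) :
    lo * ‖u‖ ^ 2 ≤ (inner ℂ u (mulOp a u)).re ∧ (inner ℂ u (mulOp a u)).re ≤ hi * ‖u‖ ^ 2 := by
  have hpt : ∀ᵐ x ∂(vol Ω), lo * (inner ℂ (u x) (u x)).re ≤ (inner ℂ (u x) (mulOp a u x)).re ∧
      (inner ℂ (u x) (mulOp a u x)).re ≤ hi * (inner ℂ (u x) (u x)).re := by
    filter_upwards [h, coeFn_mulOp a u] with x hx h1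
    have hre := quadratic_bounds hx (WithLp.toLp 2 fun i => (u x i).re)
    have him := quadratic_bounds hx (WithLp.toLp 2 fun i => (u x i).im)
    have hn : (inner ℂ (u x) (u x)).re = ‖(WithLp.toLp 2 fun i => (u x i).re : R3)‖ ^ 2 +
        ‖(WithLp.toLp 2 fun i => (u x i).im : R3)‖ ^ 2 := by
      simp only [PiLp.inner_apply, RCLike.inner_apply, EuclideanSpace.norm_sq_eq, Complex.re_sum,
        ← Finset.sum_add_distrib, Real.norm_eq_abs, sq_abs]
      refine Finset.sum_congr rfl fun i _ => ?_
      simp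
      ring
    rw [h1, re_inner_matrix, hn]
    constructor <;> linarith [hre.1, hre.2, him.1, him.2]
  have hi1 := L2.integrable_inner (𝕜 := ℂ) u u
  have hi2 := L2.integrable_inner (𝕜 := ℂ) u (mulOp a u)
  have key : ∀ v w : L2 Ω, (inner ℂ v w).re = ∫ x in (Ω : Set R3), (inner ℂ (v x) (w x)).re :=
    fun v w => by
      rw [L2.inner_def]
      exact (integral_re (L2.integrable_inner (𝕜 := ℂ) v w)).symm
  have hnorm : ‖u‖ ^ 2 = (inner ℂ u u).re := norm_sq_eq_re_inner (𝕜 := ℂ) u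
  rw [hnorm, key, key, ← integral_const_mul, ← integral_const_mul]
  exact ⟨integral_mono_ae (hi1.re.const_mul _) hi2.re (hpt.mono fun x hx => hx.1),
    integral_mono_ae hi2.re (hi1.re.const_mul _) (hpt.mono fun x hx => hx.2)⟩

end MulOp

/-! ### Test fields and integration by parts -/

section TestFields

variable {Ω : TopologicalSpace.Opens R3} {φ ψ : R3 → C3}

lemma IsTestField.memLp (h : IsTestField Ω φ) : MemLp φ 2 (vol Ω) :=
  h.smooth.continuous.memLp_of_hasCompactSupport h.compact

lemma IsTestField.memLp_curl (h : IsTestField Ω φ) : MemLp (classicalCurl φ) 2 (vol Ω) :=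
  h.continuous_curl.memLp_of_hasCompactSupport h.compact_curl

lemma inner_toLp_left (hφ : MemLp φ 2 (vol Ω)) (u : L2 Ω) :
    inner ℂ hφ.toLp u = ∫ x in (Ω : Set R3), inner ℂ (φ x) (u x) := by
  rw [L2.inner_def]
  refine integral_congr_ae ?_
  filter_upwards [hφ.coeFn_toLp] with x hx
  rw [hx]

/-- The weak formulation of `w = curl u` in terms of inner products in `L²(Ω)³`. -/
lemma isWeakCurl_iff {u w : L2 Ω} :
    IsWeakCurl u w ↔ ∀ (φ : R3 → C3) (h : IsTestField Ω φ),
      inner ℂ h.memLp_curl.toLp u = inner ℂ h.memLp.toLp w := by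
  simp only [inner_toLp_left]
  rfl

lemma IsTestField.smooth_apply (h : IsTestField Ω φ) (k : Fin 3) :
    ContDiff ℝ (⊤ : ℕ∞) fun x => φ x k :=
  ((EuclideanSpace.proj (𝕜 := ℂ) k).restrictScalars ℝ).contDiff.comp h.smooth

lemma IsTestField.compact_apply (h : IsTestField Ω φ) (k : Fin 3) :
    HasCompactSupport fun x => φ x k :=
  h.compact.comp_left (g := fun z : C3 => z k) rfl

lemma IsTestField.pderiv_eq (h : IsTestField Ω φ) (i k : Fin 3) (x : R3) :
    pderiv φ i k x = fderiv ℝ (fun y => φ y k) x (EuclideanSpace.single i 1) := by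
  have hd : DifferentiableAt ℝ φ x := h.smooth.differentiable (by simp) x
  have := (((EuclideanSpace.proj (𝕜 := ℂ) k).restrictScalars ℝ :
    C3 →L[ℝ] ℂ).hasFDerivAt.comp x hd.hasFDerivAt).fderiv
  change _ = fderiv ℝ (⇑((EuclideanSpace.proj (𝕜 := ℂ) k).restrictScalars ℝ : C3 →L[ℝ] ℂ) ∘ φ) x _
  rw [this]
  rfl

lemma IsTestField.conj_pderiv_eq (h : IsTestField Ω φ) (i k : Fin 3) (x : R3) :
    starRingEnd ℂ (pderiv φ i k x) =
      fderiv ℝ (fun y => starRingEnd ℂ (φ y k)) x (EuclideanSpace.single i 1) := by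
  have hd : DifferentiableAt ℝ (fun y => φ y k) x := (h.smooth_apply k).differentiable (by simp) x
  have := (Complex.conjCLE.toContinuousLinearMap.hasFDerivAt.comp x hd.hasFDerivAt).fderiv
  change _ = fderiv ℝ (⇑(Complex.conjCLE.toContinuousLinearMap) ∘ fun y => φ y k) x _
  rw [this, h.pderiv_eq]
  rfl

lemma IsTestField.continuous_pderiv (h : IsTestField Ω φ) (i k : Fin 3) :
    Continuous (pderiv φ i k) := by
  have h1 : Continuous fun x => fderiv ℝ φ x (EuclideanSpace.single i 1) :=
    (h.smooth.continuous_fderiv (by simp)).clm_apply continuous_const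
  exact (EuclideanSpace.proj (𝕜 := ℂ) k).continuous.comp h1

lemma IsTestField.integrable_conj_pderiv_mul (hψ : IsTestField Ω ψ) (hφ : IsTestField Ω φ)
    (i k l : Fin 3) : Integrable fun x => starRingEnd ℂ (pderiv ψ i k x) * φ x l :=
  ((Complex.continuous_conj.comp (hψ.continuous_pderiv i k)).mul
    (hφ.smooth_apply l).continuous).integrable_of_hasCompactSupport (hφ.compact_apply l).mul_left

lemma IsTestField.integrable_conj_mul_pderiv (hψ : IsTestField Ω ψ) (hφ : IsTestField Ω φ)
    (i k l : Fin 3) : Integrable fun x => starRingEnd ℂ (ψ x k) * pderiv φ i l x :=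
  ((Complex.continuous_conj.comp (hψ.smooth_apply k).continuous).mul
    (hφ.continuous_pderiv i l)).integrable_of_hasCompactSupport
      ((hψ.compact_apply k).comp_left (g := starRingEnd ℂ) (map_zero _)).mul_right

lemma IsTestField.integral_conj_pderiv_mul (hψ : IsTestField Ω ψ) (hφ : IsTestField Ω φ)
    (i k l : Fin 3) :
    ∫ x, starRingEnd ℂ (pderiv ψ i k x) * φ x l =
      -∫ x, starRingEnd ℂ (ψ x k) * pderiv φ i l x := by
  have hconj : Differentiable ℝ fun y => starRingEnd ℂ (ψ y k) :=
    Complex.conjCLE.toContinuousLinearMap.differentiable.comp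
      ((hψ.smooth_apply k).differentiable (by simp))
  have h1 := hψ.integrable_conj_pderiv_mul hφ i k l
  have h2 := hψ.integrable_conj_mul_pderiv hφ i k l
  simp only [hψ.conj_pderiv_eq, hφ.pderiv_eq] at h1 h2 ⊢
  rw [integral_mul_fderiv_eq_neg_fderiv_mul_of_integrable h1 h2, neg_neg]
  · exact ((Complex.continuous_conj.comp (hψ.smooth_apply k).continuous).mul
      (hφ.smooth_apply l).continuous).integrable_of_hasCompactSupport (hφ.compact_apply l).mul_left
  · exact fun x _ => hconj x
  · exact fun x _ => (hφ.smooth_apply l).differentiable (by simp) x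

lemma integral_sum_three_sub {a b c d e f : R3 → ℂ} (ha : Integrable a) (hb : Integrable b)
    (hc : Integrable c) (hd : Integrable d) (he : Integrable e) (hf : Integrable f) :
    ∫ x, ((a x - b x) + (c x - d x)) + (e x - f x) =
      (((∫ x, a x) - ∫ x, b x) + ((∫ x, c x) - ∫ x, d x)) + ((∫ x, e x) - ∫ x, f x) := by
  rw [← integral_sub' ha hb, ← integral_sub' hc hd, ← integral_sub' he hf,
    ← integral_add' (ha.sub hb) (hc.sub hd),
    ← integral_add' ((ha.sub hb).add (hc.sub hd)) (he.sub hf)]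
  rfl

/-- The minus sign of each integration by parts is absorbed by the antisymmetry of the curl, so the
six terms match in pairs. -/
lemma IsTestField.integral_inner_curl (hψ : IsTestField Ω ψ) (hφ : IsTestField Ω φ) :
    ∫ x, inner ℂ (classicalCurl ψ x) (φ x) = ∫ x, inner ℂ (ψ x) (classicalCurl φ x) := by
  have hA := hψ.integrable_conj_pderiv_mul hφ
  have hB := hψ.integrable_conj_mul_pderiv hφ
  have e1 : ∀ x, inner ℂ (classicalCurl ψ x) (φ x) =
      ((starRingEnd ℂ (pderiv ψ 1 2 x) * φ x 0 - starRingEnd ℂ (pderiv ψ 2 1 x) * φ x 0) +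
      (starRingEnd ℂ (pderiv ψ 2 0 x) * φ x 1 - starRingEnd ℂ (pderiv ψ 0 2 x) * φ x 1)) +
      (starRingEnd ℂ (pderiv ψ 0 1 x) * φ x 2 - starRingEnd ℂ (pderiv ψ 1 0 x) * φ x 2) := by
    intro x
    simp only [PiLp.inner_apply, RCLike.inner_apply, Fin.sum_univ_three, classicalCurl]
    simp
    ring
  have e2 : ∀ x, inner ℂ (ψ x) (classicalCurl φ x) =
      ((starRingEnd ℂ (ψ x 0) * pderiv φ 1 2 x - starRingEnd ℂ (ψ x 0) * pderiv φ 2 1 x) +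
      (starRingEnd ℂ (ψ x 1) * pderiv φ 2 0 x - starRingEnd ℂ (ψ x 1) * pderiv φ 0 2 x)) +
      (starRingEnd ℂ (ψ x 2) * pderiv φ 0 1 x - starRingEnd ℂ (ψ x 2) * pderiv φ 1 0 x) := by
    intro x
    simp only [PiLp.inner_apply, RCLike.inner_apply, Fin.sum_univ_three, classicalCurl]
    simp
    ring
  simp only [e1, e2]
  rw [integral_sum_three_sub (hA 1 2 0) (hA 2 1 0) (hA 2 0 1) (hA 0 2 1) (hA 0 1 2) (hA 1 0 2),
    integral_sum_three_sub (hB 1 0 2) (hB 2 0 1) (hB 2 1 0) (hB 0 1 2) (hB 0 2 1) (hB 1 2 0)]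
  simp only [hψ.integral_conj_pderiv_mul hφ]
  ring

/-- The distributional curl of a test field is its classical curl. -/
lemma IsTestField.isWeakCurl (hφ : IsTestField Ω φ) :
    IsWeakCurl (Ω := Ω) hφ.memLp.toLp hφ.memLp_curl.toLp := by
  intro ψ hψ
  -- Both fields vanish outside `Ω`, so the integrals may be taken over all of `ℝ³` and the boundary
  -- of `Ω` plays no role.
  have h0 : ∀ x ∉ (Ω : Set R3), φ x = 0 := fun x hx =>
    image_eq_zero_of_notMem_tsupport fun h => hx (hφ.supp h)
  have h0' : ∀ x ∉ (Ω : Set R3), ψ x = 0 := fun x hx =>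
    image_eq_zero_of_notMem_tsupport fun h => hx (hψ.supp h)
  have e1 : ∫ x in (Ω : Set R3), inner ℂ (classicalCurl ψ x) ((hφ.memLp.toLp : L2 Ω) x) =
      ∫ x in (Ω : Set R3), inner ℂ (classicalCurl ψ x) (φ x) := by
    refine integral_congr_ae ?_
    filter_upwards [hφ.memLp.coeFn_toLp] with x hx
    rw [hx]
  have e2 : ∫ x in (Ω : Set R3), inner ℂ (ψ x) ((hφ.memLp_curl.toLp : L2 Ω) x) =
      ∫ x in (Ω : Set R3), inner ℂ (ψ x) (classicalCurl φ x) := by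
    refine integral_congr_ae ?_
    filter_upwards [hφ.memLp_curl.coeFn_toLp] with x hx
    rw [hx]
  rw [e1, e2,
    setIntegral_eq_integral_of_forall_compl_eq_zero fun x hx => by rw [h0 x hx, inner_zero_right],
    setIntegral_eq_integral_of_forall_compl_eq_zero fun x hx => by rw [h0' x hx, inner_zero_left],
    hψ.integral_inner_curl hφ]

end TestFields

/-! ### Mutual adjointness of `curl` and `curl0` -/

section CurlOperators

variable {Ω : TopologicalSpace.Opens R3}

lemma IsWeakCurl.exists_curl_eq {u w : L2 Ω} (h : IsWeakCurl u w) :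
    ∃ hu : u ∈ (curl Ω).domain, curl Ω ⟨u, hu⟩ = w := by
  obtain ⟨v, rfl, hv⟩ := (LinearPMap.mem_graph_iff _).1 (mem_curl_graph.2 h)
  exact ⟨v.2, hv⟩

lemma isWeakCurl_curl (u : (curl Ω).domain) : IsWeakCurl (u : L2 Ω) (curl Ω u) :=
  mem_curl_graph.1 ((curl Ω).mem_graph u)

/-- Green's formula. -/
lemma inner_curl0_left (u : (curl0 Ω).domain) (v : (curl Ω).domain) :
    inner ℂ (curl0 Ω u) (v : L2 Ω) = inner ℂ (u : L2 Ω) (curl Ω v) :=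
  u.2.2 v

lemma inner_curl_left (u : (curl Ω).domain) (v : (curl0 Ω).domain) :
    inner ℂ (curl Ω u) (v : L2 Ω) = inner ℂ (u : L2 Ω) (curl0 Ω v) := by
  rw [← inner_conj_symm, ← inner_curl0_left, inner_conj_symm]

/-- Test fields belong to `H₀(curl, Ω)`. -/
lemma IsTestField.exists_curl0_eq {φ : R3 → C3} (hφ : IsTestField Ω φ) :
    ∃ h : hφ.memLp.toLp ∈ (curl0 Ω).domain, curl0 Ω ⟨_, h⟩ = hφ.memLp_curl.toLp := by
  obtain ⟨hu, hc⟩ := hφ.isWeakCurl.exists_curl_eq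
  refine ⟨⟨hu, fun v => ?_⟩, hc⟩
  rw [hc]
  exact isWeakCurl_iff.1 (isWeakCurl_curl v) φ hφ

/-- The adjoint of `curl₀` is contained in `curl`. -/
lemma exists_curl_eq_of_forall_inner {u w : L2 Ω}
    (h : ∀ v : (curl0 Ω).domain, inner ℂ (curl0 Ω v) u = inner ℂ (v : L2 Ω) w) :
    ∃ hu : u ∈ (curl Ω).domain, curl Ω ⟨u, hu⟩ = w := by
  refine IsWeakCurl.exists_curl_eq (isWeakCurl_iff.2 fun φ hφ => ?_)
  obtain ⟨h0, hc⟩ := hφ.exists_curl0_eq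
  rw [← hc]
  exact h ⟨_, h0⟩

/-- The adjoint of `curl` is contained in `curl₀`. -/
lemma exists_curl0_eq_of_forall_inner {u w : L2 Ω}
    (h : ∀ v : (curl Ω).domain, inner ℂ (curl Ω v) u = inner ℂ (v : L2 Ω) w) :
    ∃ hu : u ∈ (curl0 Ω).domain, curl0 Ω ⟨u, hu⟩ = w := by
  -- Testing only against `H₀(curl, Ω)` already yields `curl u = w`; the full hypothesis is then the
  -- Green formula that defines `H₀(curl, Ω)`.
  obtain ⟨hu, hc⟩ := exists_curl_eq_of_forall_inner (u := u) (w := w) fun v => h ⟨v, v.2.1⟩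
  refine ⟨⟨hu, fun v => ?_⟩, hc⟩
  rw [hc, ← inner_conj_symm, ← h v, inner_conj_symm]

end CurlOperators

/-! ### The Maxwell pencil and its formal adjoint -/

section Pencil

variable {Ω : TopologicalSpace.Opens R3} {ε μ σ : LinftyMatrix Ω} {ω : ℂ}

lemma pencil_apply_fst (u : (pencil ε μ σ ω).domain) :
    (pencil ε μ σ ω u).fst = -Complex.I • mulOp σ (u : L2L2 Ω).fst +
      Complex.I • curl Ω ⟨(u : L2L2 Ω).snd, u.2.2⟩ - ω • mulOp ε (u : L2L2 Ω).fst := rfl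

lemma pencil_apply_snd (u : (pencil ε μ σ ω).domain) :
    (pencil ε μ σ ω u).snd =
      -Complex.I • curl0 Ω ⟨(u : L2L2 Ω).fst, u.2.1⟩ - ω • mulOp μ (u : L2L2 Ω).snd := rfl

lemma inner_L2L2 (u v : L2L2 Ω) :
    inner ℂ u v = inner ℂ u.fst v.fst + inner ℂ u.snd v.snd := rfl

/-- `V(ω)` and the pencil with `σ`, `ω` replaced by `-σ`, `ω̄` are formally adjoint. -/
lemma inner_pencil_left (hε : ε.IsSymm) (hμ : μ.IsSymm) (hσ : σ.IsSymm)
    (w : (pencil ε μ (-σ) (starRingEnd ℂ ω)).domain) (u : (pencil ε μ σ ω).domain) :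
    inner ℂ (pencil ε μ (-σ) (starRingEnd ℂ ω) w) (u : L2L2 Ω) =
      inner ℂ (w : L2L2 Ω) (pencil ε μ σ ω u) := by
  have h1 := inner_curl0_left ⟨(w : L2L2 Ω).fst, w.2.1⟩ ⟨(u : L2L2 Ω).snd, u.2.2⟩
  have h2 := inner_curl_left ⟨(w : L2L2 Ω).snd, w.2.2⟩ ⟨(u : L2L2 Ω).fst, u.2.1⟩
  simp only [inner_L2L2, pencil_apply_fst, pencil_apply_snd, mulOp_neg, inner_add_left,
    inner_sub_left, inner_add_right, inner_sub_right, inner_smul_left, inner_smul_right,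
    inner_neg_left, map_neg, Complex.conj_I, Complex.conj_conj, inner_mulOp_symm hε,
    inner_mulOp_symm hμ, inner_mulOp_symm hσ, h1, h2]
  ring

/-- The adjoint of the pencil with `-σ`, `ω̄` is contained in `V(ω)`. -/
lemma exists_pencil_eq_of_forall_inner (hε : ε.IsSymm) (hμ : μ.IsSymm) (hσ : σ.IsSymm)
    {u f : L2L2 Ω}
    (h : ∀ w : (pencil ε μ (-σ) (starRingEnd ℂ ω)).domain,
      inner ℂ (pencil ε μ (-σ) (starRingEnd ℂ ω) w) u = inner ℂ (w : L2L2 Ω) f) :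
    ∃ hu : u ∈ (pencil ε μ σ ω).domain, pencil ε μ σ ω ⟨u, hu⟩ = f := by
  have hI : Complex.I * Complex.I = -1 := Complex.I_mul_I
  -- Pairs `(v, 0)` isolate the first component; `w` is what `curl H` must be when that equation is
  -- solved for it.
  obtain ⟨h2, hc2⟩ := exists_curl_eq_of_forall_inner (u := u.snd)
    (w := -Complex.I • f.fst + mulOp σ u.fst - (Complex.I * ω) • mulOp ε u.fst) fun v => by
      have h0 : curl Ω ⟨(0 : L2 Ω), Submodule.zero_mem _⟩ = 0 := (curl Ω).map_zero
      have h1 : inner ℂ (-Complex.I • mulOp (-σ) (v : L2 Ω) +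
            Complex.I • curl Ω ⟨(0 : L2 Ω), Submodule.zero_mem _⟩ -
            starRingEnd ℂ ω • mulOp ε (v : L2 Ω)) u.fst +
          inner ℂ (-Complex.I • curl0 Ω v - starRingEnd ℂ ω • mulOp μ 0) u.snd =
          inner ℂ (v : L2 Ω) f.fst + inner ℂ 0 f.snd :=
        h ⟨WithLp.toLp 2 (v, 0), v.2, Submodule.zero_mem _⟩
      simp only [mulOp_neg, inner_add_left, inner_sub_left, inner_smul_left, inner_neg_left,
        map_neg, Complex.conj_I, Complex.conj_conj, inner_mulOp_symm hε, inner_mulOp_symm hσ, h0,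
        map_zero, inner_zero_left] at h1
      simp only [inner_add_right, inner_sub_right, inner_smul_right]
      linear_combination (-Complex.I) * h1 + (inner ℂ (curl0 Ω v) u.snd -
        inner ℂ (v : L2 Ω) (mulOp σ u.fst)) * hI
  -- Likewise pairs `(0, v)` isolate the second component, solved for `curl0 E`.
  obtain ⟨h1, hc1⟩ := exists_curl0_eq_of_forall_inner (u := u.fst)
    (w := Complex.I • f.snd + (Complex.I * ω) • mulOp μ u.snd) fun v => by
      have h0 : curl0 Ω ⟨(0 : L2 Ω), Submodule.zero_mem _⟩ = 0 := (curl0 Ω).map_zero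
      have h1 : inner ℂ (-Complex.I • mulOp (-σ) 0 + Complex.I • curl Ω v -
            starRingEnd ℂ ω • mulOp ε 0) u.fst +
          inner ℂ (-Complex.I • curl0 Ω ⟨(0 : L2 Ω), Submodule.zero_mem _⟩ -
            starRingEnd ℂ ω • mulOp μ (v : L2 Ω)) u.snd =
          inner ℂ 0 f.fst + inner ℂ (v : L2 Ω) f.snd :=
        h ⟨WithLp.toLp 2 (0, v), Submodule.zero_mem _, v.2⟩
      simp only [inner_add_left, inner_sub_left, inner_smul_left, Complex.conj_I,
        Complex.conj_conj, inner_mulOp_symm hμ, h0, map_zero, inner_zero_left] at h1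
      simp only [inner_add_right, inner_smul_right]
      linear_combination Complex.I * h1 + inner ℂ (curl Ω v) u.fst * hI
  refine ⟨⟨h1, h2⟩, ?_⟩
  refine (WithLp.ofLp_injective 2) (Prod.ext ?_ ?_)
  · change (pencil ε μ σ ω ⟨u, _⟩).fst = f.fst
    rw [pencil_apply_fst]
    simp only [hc2, smul_add, smul_sub, smul_smul, neg_smul, ← mul_assoc, hI, smul_neg]
    module
  · change (pencil ε μ σ ω ⟨u, _⟩).snd = f.snd
    rw [pencil_apply_snd]
    simp only [hc1, smul_add, smul_smul, neg_mul, ← mul_assoc, hI]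
    module

/-- As `V(ω)` is a full adjoint, its graph is cut out by closed conditions, one for each vector in
the domain of the formal adjoint. -/
lemma pencil_isClosed (hε : ε.IsSymm) (hμ : μ.IsSymm) (hσ : σ.IsSymm) :
    (pencil ε μ σ ω).IsClosed := by
  have hset : ((pencil ε μ σ ω).graph : Set (L2L2 Ω × L2L2 Ω)) =
      ⋂ w : (pencil ε μ (-σ) (starRingEnd ℂ ω)).domain,
        {p | inner ℂ (pencil ε μ (-σ) (starRingEnd ℂ ω) w) p.1 = inner ℂ (w : L2L2 Ω) p.2} := by
    ext p
    simp only [SetLike.mem_coe, LinearPMap.mem_graph_iff, Set.mem_iInter, Set.mem_ofPred_eq]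
    constructor
    · rintro ⟨u, hu1, hu2⟩ w
      rw [← hu1, ← hu2]
      exact inner_pencil_left hε hμ hσ w u
    · intro h
      obtain ⟨hu, hf⟩ := exists_pencil_eq_of_forall_inner hε hμ hσ h
      exact ⟨⟨p.1, hu⟩, rfl, hf⟩
  rw [LinearPMap.IsClosed, hset]
  exact isClosed_iInter fun w => isClosed_eq (continuous_const.inner continuous_fst)
    (continuous_const.inner continuous_snd)

/-- The pencil is boundedly invertible once it and its formal adjoint are bounded below. -/
lemma exists_isBoundedInverse_pencil (hε : ε.IsSymm) (hμ : μ.IsSymm) (hσ : σ.IsSymm) {c : ℝ}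
    (hc : 0 < c) (hV : ∀ u : (pencil ε μ σ ω).domain, c * ‖u‖ ≤ ‖pencil ε μ σ ω u‖)
    (hV' : ∀ w : (pencil ε μ (-σ) (starRingEnd ℂ ω)).domain,
      c * ‖w‖ ≤ ‖pencil ε μ (-σ) (starRingEnd ℂ ω) w‖) :
    ∃ R : L2L2 Ω →L[ℂ] L2L2 Ω, IsBoundedInverse (pencil ε μ σ ω) R := by
  refine exists_isBoundedInverse (pencil_isClosed hε hμ hσ) hc hV fun w hw => ?_
  -- A vector orthogonal to the range of `V(ω)` lies in the kernel of the formal adjoint, whose own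
  -- formal adjoint is `V(ω)` again.
  obtain ⟨h, h0⟩ := exists_pencil_eq_of_forall_inner (σ := -σ) (ω := starRingEnd ℂ ω) (u := w)
    (f := 0) hε hμ hσ.neg (by
      rw [neg_neg, Complex.conj_conj]
      intro u
      rw [hw u, inner_zero_right])
  have h1 := hV' ⟨w, h⟩
  rw [h0, norm_zero] at h1
  have h2 : ‖w‖ ≤ 0 := by
    by_contra! h3
    exact absurd h1 (not_le.2 (mul_pos hc h3))
  exact norm_le_zero_iff.1 h2

/-! ### Lower bounds from the quadratic form -/

section LowerBounds

/-- With `z = ⟨E, curl H⟩`, Green's formula makes the curl terms `iz` and `-i z̄`. Their sum is real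
and their difference imaginary, so both vanish from the parts taken here. -/
lemma pencil_quadratic_form (hε : ε.IsSymm) (hμ : μ.IsSymm) (hσ : σ.IsSymm)
    (u : (pencil ε μ σ ω).domain) :
    (inner ℂ (u : L2L2 Ω).fst (pencil ε μ σ ω u).fst).re -
        (inner ℂ (u : L2L2 Ω).snd (pencil ε μ σ ω u).snd).re =
      -ω.re * ((inner ℂ (u : L2L2 Ω).fst (mulOp ε (u : L2L2 Ω).fst)).re -
        (inner ℂ (u : L2L2 Ω).snd (mulOp μ (u : L2L2 Ω).snd)).re) ∧
    (inner ℂ (u : L2L2 Ω).fst (pencil ε μ σ ω u).fst).im +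
        (inner ℂ (u : L2L2 Ω).snd (pencil ε μ σ ω u).snd).im =
      -(inner ℂ (u : L2L2 Ω).fst (mulOp σ (u : L2L2 Ω).fst)).re -
      ω.im * ((inner ℂ (u : L2L2 Ω).fst (mulOp ε (u : L2L2 Ω).fst)).re +
        (inner ℂ (u : L2L2 Ω).snd (mulOp μ (u : L2L2 Ω).snd)).re) := by
  have h1 := inner_curl0_left ⟨(u : L2L2 Ω).fst, u.2.1⟩ ⟨(u : L2L2 Ω).snd, u.2.2⟩
  rw [← inner_conj_symm] at h1
  have hre := congrArg Complex.re h1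
  have him := congrArg Complex.im h1
  rw [Complex.conj_re] at hre
  rw [Complex.conj_im] at him
  rw [pencil_apply_fst, pencil_apply_snd]
  simp only [inner_add_right, inner_sub_right, inner_smul_right]
  simp only [Complex.add_re, Complex.sub_re, Complex.mul_re, Complex.add_im, Complex.sub_im,
    Complex.mul_im, Complex.neg_re, Complex.neg_im, Complex.I_re, Complex.I_im,
    im_inner_mulOp hε, im_inner_mulOp hμ, im_inner_mulOp hσ]
  constructor
  · linear_combination him
  · linear_combination -hre

/-- The Cauchy–Schwarz inequality in `ℝ²` gives the factor `√(1 + b²)`; the weaker `1 + b²` is the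
one in the stated resolvent bound. -/
lemma abs_im_add_mul_abs_re_le (b : ℝ) (z : ℂ) :
    |z.im| + b * |z.re| ≤ (1 + b ^ 2) * ‖z‖ := by
  refine abs_le_of_sq_le_sq' ?_ (by positivity) |>.2
  rw [mul_pow, Complex.sq_norm, Complex.normSq_apply]
  nlinarith [sq_nonneg (b * |z.im| - |z.re|), sq_abs z.im, sq_abs z.re, sq_nonneg b,
    mul_nonneg (sq_nonneg b) (add_nonneg (sq_nonneg z.re) (sq_nonneg z.im)),
    mul_nonneg (sq_nonneg (b ^ 2)) (add_nonneg (sq_nonneg z.re) (sq_nonneg z.im))]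

lemma abs_im_add_re_sub_le_norm_mul {b : ℝ} (hb : 0 ≤ b) (u v : L2L2 Ω) :
    |(inner ℂ u.fst v.fst).im + (inner ℂ u.snd v.snd).im| +
        b * |(inner ℂ u.fst v.fst).re - (inner ℂ u.snd v.snd).re| ≤
      (1 + b ^ 2) * (‖u‖ * ‖v‖) := by
  have h1 := abs_im_add_mul_abs_re_le b (inner ℂ u.fst v.fst)
  have h2 := abs_im_add_mul_abs_re_le b (inner ℂ u.snd v.snd)
  have h3 := abs_add_le (inner ℂ u.fst v.fst).im (inner ℂ u.snd v.snd).im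
  have h4 := mul_le_mul_of_nonneg_left
    (abs_sub (inner ℂ u.fst v.fst).re (inner ℂ u.snd v.snd).re) hb
  have h5 : ‖inner ℂ u.fst v.fst‖ + ‖inner ℂ u.snd v.snd‖ ≤ ‖u‖ * ‖v‖ := by
    refine (add_le_add (norm_inner_le_norm _ _) (norm_inner_le_norm _ _)).trans ?_
    refine abs_le_of_sq_le_sq' ?_ (by positivity) |>.2
    rw [mul_pow, WithLp.prod_norm_sq_eq_of_L2, WithLp.prod_norm_sq_eq_of_L2]
    nlinarith [sq_nonneg (‖u.fst‖ * ‖v.snd‖ - ‖u.snd‖ * ‖v.fst‖)]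
  have h6 := mul_le_mul_of_nonneg_left h5 (by positivity : 0 ≤ 1 + b ^ 2)
  linarith

variable {εmin μmin s τ κ : ℝ}

lemma min_mul_norm_sq_le
    (hε : ∀ E : L2 Ω, εmin * ‖E‖ ^ 2 ≤ (inner ℂ E (mulOp ε E)).re)
    (hμ : ∀ H : L2 Ω, μmin * ‖H‖ ^ 2 ≤ (inner ℂ H (mulOp μ H)).re) (u : L2L2 Ω) :
    min εmin μmin * ‖u‖ ^ 2 ≤
      (inner ℂ u.fst (mulOp ε u.fst)).re + (inner ℂ u.snd (mulOp μ u.snd)).re := by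
  rw [WithLp.prod_norm_sq_eq_of_L2, mul_add]
  exact add_le_add
    ((mul_le_mul_of_nonneg_right (min_le_left _ _) (sq_nonneg _)).trans (hε u.fst))
    ((mul_le_mul_of_nonneg_right (min_le_right _ _) (sq_nonneg _)).trans (hμ u.snd))

lemma mul_le_of_mul_sq_le {c x y : ℝ} (hx : 0 ≤ x) (hy : 0 ≤ y) (h : c * x ^ 2 ≤ x * y) :
    c * x ≤ y := by
  rcases hx.eq_or_lt with rfl | hx
  · simpa using hy
  · refine le_of_mul_le_mul_left ?_ hx
    linarith

/-- The lower bound for the pencil away from the imaginary axis. The sign `κ` covers both the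
pencil (`κ = 1`) and its formal adjoint (`κ = -1`). -/
lemma pencil_lower_bound_of_re_ne_zero
    (hε : ε.IsSymm) (hμ : μ.IsSymm) (hσ : σ.IsSymm) (hs : 0 ≤ s) (hτ : s ≤ τ) (hκ : |κ| = 1)
    (hω : κ * ω.im = -τ) (hre : ω.re ≠ 0)
    (hεb : ∀ E : L2 Ω, εmin * ‖E‖ ^ 2 ≤ (inner ℂ E (mulOp ε E)).re)
    (hμb : ∀ H : L2 Ω, μmin * ‖H‖ ^ 2 ≤ (inner ℂ H (mulOp μ H)).re)
    (hσb : ∀ E : L2 Ω,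
      κ * (inner ℂ E (mulOp σ E)).re ≤ 2 * s * (inner ℂ E (mulOp ε E)).re)
    (u : (pencil ε μ σ ω).domain) :
    min εmin μmin * (τ - s) / (1 + s ^ 2 / ω.re ^ 2) * ‖u‖ ≤ ‖pencil ε μ σ ω u‖ := by
  obtain ⟨hR, hI⟩ := pencil_quadratic_form hε hμ hσ u
  -- This weight turns the real part, of size `|Re ω| |e - h|`, into exactly the error `s|e - h|`.
  have hb := abs_im_add_re_sub_le_norm_mul (b := s / |ω.re|) (by positivity) u
    (pencil ε μ σ ω u)
  have hm := mul_le_mul_of_nonneg_left (min_mul_norm_sq_le hεb hμb u) (sub_nonneg.2 hτ)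
  have hq := hσb (u : L2L2 Ω).fst
  rw [hR, hI, div_pow, sq_abs, abs_mul, abs_neg, ← mul_assoc,
    div_mul_cancel₀ _ (abs_ne_zero.2 hre)] at hb
  set e := (inner ℂ (u : L2L2 Ω).fst (mulOp ε (u : L2L2 Ω).fst)).re
  set h := (inner ℂ (u : L2L2 Ω).snd (mulOp μ (u : L2L2 Ω).snd)).re
  set q := (inner ℂ (u : L2L2 Ω).fst (mulOp σ (u : L2L2 Ω).fst)).re
  have h1 : κ * (-q - ω.im * (e + h)) ≤ |-q - ω.im * (e + h)| := by
    refine (le_abs_self _).trans ?_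
    rw [abs_mul, hκ, one_mul]
  have h2 : κ * (-q - ω.im * (e + h)) = -(κ * q) + τ * (e + h) := by
    linear_combination -(e + h) * hω
  -- Used with the splitting `2s e = s(e + h) + s(e - h)`, which leaves `(τ - s)(e + h)`.
  have h3 := mul_le_mul_of_nonneg_left (le_abs_self (e - h)) hs
  have hpos : 0 < 1 + s ^ 2 / ω.re ^ 2 := by positivity
  rw [div_mul_eq_mul_div, div_le_iff₀' hpos]
  refine mul_le_of_mul_sq_le (norm_nonneg _) (by positivity) ?_
  have hu : ‖u‖ = ‖(u : L2L2 Ω)‖ := rfl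
  rw [hu]
  linarith

/-- The lower bound for the pencil below the real line. The sign `κ` covers both the pencil
(`κ = 1`) and its formal adjoint (`κ = -1`). -/
lemma pencil_lower_bound
    (hε : ε.IsSymm) (hμ : μ.IsSymm) (hσ : σ.IsSymm) (hs : 0 ≤ s) (hτ : 2 * s ≤ τ) (hκ : |κ| = 1)
    (hω : κ * ω.im = -τ) (hμmin : 0 ≤ μmin)
    (hεb : ∀ E : L2 Ω, εmin * ‖E‖ ^ 2 ≤ (inner ℂ E (mulOp ε E)).re)
    (hμb : ∀ H : L2 Ω, μmin * ‖H‖ ^ 2 ≤ (inner ℂ H (mulOp μ H)).re)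
    (hσb : ∀ E : L2 Ω,
      κ * (inner ℂ E (mulOp σ E)).re ≤ 2 * s * (inner ℂ E (mulOp ε E)).re)
    (u : (pencil ε μ σ ω).domain) :
    min εmin μmin * (τ - 2 * s) * ‖u‖ ≤ ‖pencil ε μ σ ω u‖ := by
  obtain ⟨-, hI⟩ := pencil_quadratic_form hε hμ hσ u
  -- Here `b = 0`: the real part is discarded, so no condition on `Re ω` is needed.
  have hb := abs_im_add_re_sub_le_norm_mul le_rfl u (pencil ε μ σ ω u)
  have hm := mul_le_mul_of_nonneg_left (min_mul_norm_sq_le hεb hμb u) (sub_nonneg.2 hτ)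
  have hq := hσb (u : L2L2 Ω).fst
  have hh : 0 ≤ (inner ℂ (u : L2L2 Ω).snd (mulOp μ (u : L2L2 Ω).snd)).re :=
    (mul_nonneg hμmin (sq_nonneg _)).trans (hμb (u : L2L2 Ω).snd)
  rw [hI] at hb
  set e := (inner ℂ (u : L2L2 Ω).fst (mulOp ε (u : L2L2 Ω).fst)).re
  set h := (inner ℂ (u : L2L2 Ω).snd (mulOp μ (u : L2L2 Ω).snd)).re
  set q := (inner ℂ (u : L2L2 Ω).fst (mulOp σ (u : L2L2 Ω).fst)).re
  have h1 : κ * (-q - ω.im * (e + h)) ≤ |-q - ω.im * (e + h)| := by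
    refine (le_abs_self _).trans ?_
    rw [abs_mul, hκ, one_mul]
  have h2 : κ * (-q - ω.im * (e + h)) = -(κ * q) + τ * (e + h) := by
    linear_combination -(e + h) * hω
  -- Since `h ≥ 0`, the loss `2s e` is at most `2s(e + h)`.
  have h3 := mul_nonneg hs hh
  refine mul_le_of_mul_sq_le (norm_nonneg _) (norm_nonneg _) ?_
  have hu : ‖u‖ = ‖(u : L2L2 Ω)‖ := rfl
  rw [hu]
  linarith

end LowerBounds

end Pencil

end Maxwell

end

/-! ### The resolvent estimates -/

theorem theorem2p2 (Ω : TopologicalSpace.Opens Maxwell.R3)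
    (ε μ σ : Maxwell.LinftyMatrix Ω)
    (εmin εmax μmin μmax σmax : ℝ)
    (hεmin : 0 < εmin) (hμmin : 0 < μmin)
    (hε_symm : ε.IsSymm) (hμ_symm : μ.IsSymm) (hσ_symm : σ.IsSymm)
    (hε : Maxwell.FormBounds ε εmin εmax)
    (hμ : Maxwell.FormBounds μ μmin μmax)
    (hσ : Maxwell.FormBounds σ 0 σmax) :
    (∀ ω : ℂ, ω.re ≠ 0 → ω.im < -(1 / 2 * (σmax / εmin)) →
      ∃ R : Maxwell.L2L2 Ω →L[ℂ] Maxwell.L2L2 Ω,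
        Maxwell.IsBoundedInverse (Maxwell.pencil ε μ σ ω) R ∧
        ‖R‖ ≤ 1 / min εmin μmin * (1 / (|ω.im| - 1 / 2 * (σmax / εmin))) *
          (1 + (1 / 2 * (σmax / εmin)) ^ 2 / ω.re ^ 2)) ∧
    (∀ ω : ℂ, ω.im < -(σmax / εmin) →
      ∃ R : Maxwell.L2L2 Ω →L[ℂ] Maxwell.L2L2 Ω,
        Maxwell.IsBoundedInverse (Maxwell.pencil ε μ σ ω) R ∧
        ‖R‖ ≤ 1 / min εmin μmin *
          (if ω.re = 0 then 1 / (|ω.im| - σmax / εmin)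
          else min
            (1 / (|ω.im| - 1 / 2 * (σmax / εmin)) *
              (1 + (1 / 2 * (σmax / εmin)) ^ 2 / ω.re ^ 2))
            (1 / (|ω.im| - σmax / εmin)))) := by
  have hm : 0 < min εmin μmin := lt_min hεmin hμmin
  have hεb := fun E => (hε.re_inner_bounds E).1
  have hμb := fun H => (hμ.re_inner_bounds H).1
  have hσb := hσ.re_inner_bounds
  rcases lt_or_ge σmax 0 with hneg | hσ0
  · -- a negative upper bound for `σ` forces `Ω` to be empty
    have h0 : ∀ E : Maxwell.L2 Ω, E = 0 := fun E => by
      have h1 := (hσb E).1.trans (hσb E).2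
      by_contra hE
      have : 0 < ‖E‖ ^ 2 := by positivity
      nlinarith
    have hz : ∀ u : Maxwell.L2L2 Ω, u = 0 := fun u =>
      WithLp.ofLp_injective 2 (Prod.ext (h0 _) (h0 _))
    have hinv : ∀ ω, Maxwell.IsBoundedInverse (Maxwell.pencil ε μ σ ω) 0 := fun ω =>
      ⟨fun f => ⟨Submodule.zero_mem _, (hz _).trans (hz _).symm⟩, fun u => (hz _).trans (hz _).symm⟩
    have hd : σmax / εmin < 0 := div_neg_of_neg_of_pos hneg hεmin
    have hp1 : ∀ ω : ℂ, 0 < |ω.im| - σmax / εmin := fun ω => by linarith [abs_nonneg ω.im]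
    have hp2 : ∀ ω : ℂ, 0 < |ω.im| - 1 / 2 * (σmax / εmin) := fun ω => by
      linarith [abs_nonneg ω.im]
    refine ⟨fun ω _ _ => ⟨0, hinv ω, ?_⟩, fun ω _ => ⟨0, hinv ω, ?_⟩⟩
    · have := hp2 ω
      rw [norm_zero]
      positivity
    · have h1 := hp1 ω
      have h2 := hp2 ω
      rw [norm_zero]
      split_ifs <;> positivity
  set s := 1 / 2 * (σmax / εmin) with hs
  have hs0 : 0 ≤ s := by positivity
  have h2s : σmax / εmin = 2 * s := by rw [hs]; ring
  -- As forms, `σ ≤ σmax ≤ (σmax / εmin) ε`, and `2s = σmax / εmin`.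
  have hσ1 : ∀ E, 1 * (inner ℂ E (Maxwell.mulOp σ E)).re ≤
      2 * s * (inner ℂ E (Maxwell.mulOp ε E)).re := fun E => by
    have h1 := mul_le_mul_of_nonneg_left (hεb E) (by positivity : 0 ≤ 2 * s)
    have h2 : 2 * s * (εmin * ‖E‖ ^ 2) = σmax * ‖E‖ ^ 2 := by
      rw [← h2s]
      field_simp
    linarith [(hσb E).2]
  -- For the formal adjoint the sign `κ = -1` cancels the sign of `-σ`.
  have hσ2 : ∀ E, -1 * (inner ℂ E (Maxwell.mulOp (-σ) E)).re ≤
      2 * s * (inner ℂ E (Maxwell.mulOp ε E)).re := fun E => by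
    rw [Maxwell.mulOp_neg, inner_neg_right, Complex.neg_re]
    linarith [hσ1 E]
  have habs : |(-1 : ℝ)| = 1 := by simp
  have hsq : ∀ ω : ℂ, 0 < 1 + s ^ 2 / ω.re ^ 2 := fun ω => by positivity
  rw [h2s]
  refine ⟨fun ω hre him => ?_, fun ω him => ?_⟩
  · have hτ : |ω.im| = -ω.im := abs_of_neg (by linarith)
    rw [hτ]
    have hpos : 0 < -ω.im - s := by linarith
    have hc : 0 < min εmin μmin * (-ω.im - s) / (1 + s ^ 2 / ω.re ^ 2) :=
      div_pos (mul_pos hm hpos) (hsq ω)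
    have hV := Maxwell.pencil_lower_bound_of_re_ne_zero (κ := 1) (ω := ω) (τ := -ω.im)
      hε_symm hμ_symm hσ_symm hs0 (by linarith) abs_one (by ring) hre hεb hμb hσ1
    have hV' := Maxwell.pencil_lower_bound_of_re_ne_zero (κ := -1) (ω := starRingEnd ℂ ω)
      (τ := -ω.im) hε_symm hμ_symm hσ_symm.neg hs0 (by linarith) habs (by simp) (by simpa using hre)
      hεb hμb hσ2
    rw [Complex.conj_re] at hV'
    obtain ⟨R, hR⟩ := Maxwell.exists_isBoundedInverse_pencil hε_symm hμ_symm hσ_symm hc hV hV'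
    refine ⟨R, hR, (hR.norm_le hc hV).trans_eq ?_⟩
    rw [inv_div, div_eq_mul_inv, mul_inv, one_div, one_div]
    ring
  · have hτ : |ω.im| = -ω.im := abs_of_neg (by linarith)
    rw [hτ]
    have hpos : 0 < -ω.im - 2 * s := by linarith
    have hpos' : 0 < -ω.im - s := by linarith
    have hc : 0 < min εmin μmin * (-ω.im - 2 * s) := mul_pos hm hpos
    have hV := Maxwell.pencil_lower_bound (κ := 1) (ω := ω) (τ := -ω.im)
      hε_symm hμ_symm hσ_symm hs0 (by linarith) abs_one (by ring) hμmin.le hεb hμb hσ1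
    have hV' := Maxwell.pencil_lower_bound (κ := -1) (ω := starRingEnd ℂ ω)
      (τ := -ω.im) hε_symm hμ_symm hσ_symm.neg hs0 (by linarith) habs (by simp) hμmin.le
      hεb hμb hσ2
    obtain ⟨R, hR⟩ := Maxwell.exists_isBoundedInverse_pencil hε_symm hμ_symm hσ_symm hc hV hV'
    have hR2 : ‖R‖ ≤ 1 / min εmin μmin * (1 / (-ω.im - 2 * s)) := by
      refine (hR.norm_le hc hV).trans_eq ?_
      rw [mul_inv, one_div, one_div]
    refine ⟨R, hR, ?_⟩
    split_ifs with hre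
    · exact hR2
    · rw [mul_min_of_nonneg _ _ (by positivity)]
      refine le_min ?_ hR2
      -- Off the imaginary axis the first bound also applies, because `τ > 2s ≥ s`; it estimates the
      -- same inverse `R`.
      have hW := Maxwell.pencil_lower_bound_of_re_ne_zero (κ := 1) (ω := ω) (τ := -ω.im)
        hε_symm hμ_symm hσ_symm hs0 (by linarith) abs_one (by ring) hre hεb hμb hσ1
      refine (hR.norm_le (div_pos (mul_pos hm hpos') (hsq ω)) hW).trans_eq ?_
      rw [inv_div, div_eq_mul_inv, mul_inv, one_div, one_div]
      ring
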